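/- Let $\Omega\subset\mathbb R^d$ be compact with Lebesgue-negligible boundary, let $\mu,\nu$ be Borel probability measures on $\mathbb R^d$ concentrated on $\Omega$, and let $\mu$ be absolutely continuous with respect to Lebesgue measure. Let $h:\mathbb R^d\to\mathbb R$ be strictly convex, let $\Phi_\mu,\Phi_\nu:\mathbb R^d\to\mathbb R^d$ be $C^1$-diffeomorphisms, and put $c(x,y)=h(\Phi_\mu(x)-\Phi_\nu(y))$. Write $\Gamma(\mu,\nu)$ for the set of couplings of $\mu$ and $\nu$. Then $c$ is integrable with respect to every $\pi\in\Gamma(\mu,\nu)$, the Kantorovich problem $$\min_{\pi\in\Gamma(\mu,\nu)}\iint c(x,y)\,\mathrm d\pi(x,y)$$ has exactly one solution $\pi^\star$, and $\pi^\star=(\mathrm{Id},T^\star)_\#\mu$ for a Borel map $T^\star:\mathbb R^d\to\mathbb R^d$. Moreover there is a Kantorovich potential $f^\star$ for the marginals $\tilde\mu=(\Phi_\mu)_\#\mu$, $\tilde\nu=(\Phi_\nu)_\#\nu$ and the cost $h(x-y)$ such that, for $\mu$-almost every $x$, $f^\star$ is differentiable at $\Phi_\mu(x)$ and $$T^\star(x)=\Phi_\nu^{-1}\Big[\Phi_\mu(x)-(\nabla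 h)^{-1}\big(\nabla f^\star(\Phi_\mu(x))\big)\Big].$$ Here a Kantorovich potential is the first component $f$ of a pair $(f,g)$ that maximizes $\int f\,\mathrm d\tilde\mu+\int g\,\mathrm d\tilde\nu$ over all $(f,g)\in L^1(\tilde\mu)\times L^1(\tilde\nu)$ with $f(x)+g(y)\le h(x-y)$ for $\tilde\mu\otimes\tilde\nu$-almost every $(x,y)$; and $(\nabla h)^{-1}(p)$ is the unique $z$ with $p\in\partial h(z)$, where $\partial h(z)=\{p: h(w)\ge h(z)+\langle p,w-z\rangle\ \text{for all } w\in\mathbb R^d\}$ (which is $\{\nabla h(z)\}$ where $h$ is differentiable); such a $z$ exists for $p=\nabla f^\star(\Phi_\mu(x))$, for $\mu$-almost every $x$. -/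

import Mathlib

open MeasureTheory
open scoped Manifold

noncomputable section

namespace OptimalTransport

/-- `π ∈ Γ(μ, ν)`: `π` is a coupling (transport plan) of `μ` and `ν`. -/
def IsCoupling {X Y : Type*} [MeasurableSpace X] [MeasurableSpace Y]
    (μ : Measure X) (ν : Measure Y) (π : Measure (X × Y)) : Prop :=
  π.map Prod.fst = μ ∧ π.map Prod.snd = ν

/-- `π` solves the Kantorovich problem for the cost `c` and the marginals `μ`, `ν`. -/
def IsOptimalPlan {X Y : Type*} [MeasurableSpace X] [MeasurableSpace Y]
    (c : X → Y → ℝ) (μ : Measure X) (ν : Measure Y) (π : Measure (X × Y)) : Prop :=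
  IsCoupling μ ν π ∧ Integrable (fun p : X × Y => c p.1 p.2) π ∧
    ∀ π' : Measure (X × Y), IsCoupling μ ν π' →
      ∫ p, c p.1 p.2 ∂π ≤ ∫ p, c p.1 p.2 ∂π'

/-- The admissible set of the dual problem: `(f, g) ∈ L¹(μ) × L¹(ν)` with
`f x + g y ≤ c x y` for `μ ⊗ ν`-almost every `(x, y)`. -/
def IsDualAdmissible {X Y : Type*} [MeasurableSpace X] [MeasurableSpace Y]
    (c : X → Y → ℝ) (μ : Measure X) (ν : Measure Y) (f : X → ℝ) (g : Y → ℝ) : Prop :=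
  Integrable f μ ∧ Integrable g ν ∧ ∀ᵐ p ∂(μ.prod ν), f p.1 + g p.2 ≤ c p.1 p.2

/-- `(f, g)` solves the dual Kantorovich problem, i.e. it is an admissible pair that maximizes
`∫ f dμ + ∫ g dν` over all admissible pairs. -/
def IsDualSolution {X Y : Type*} [MeasurableSpace X] [MeasurableSpace Y]
    (c : X → Y → ℝ) (μ : Measure X) (ν : Measure Y) (f : X → ℝ) (g : Y → ℝ) : Prop :=
  IsDualAdmissible c μ ν f g ∧
    ∀ (f' : X → ℝ) (g' : Y → ℝ), IsDualAdmissible c μ ν f' g' →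
      ∫ x, f' x ∂μ + ∫ y, g' y ∂ν ≤ ∫ x, f x ∂μ + ∫ y, g y ∂ν

/-- `f` is a Kantorovich potential: the first component of a solution of the dual problem. -/
def IsKantorovichPotential {X Y : Type*} [MeasurableSpace X] [MeasurableSpace Y]
    (c : X → Y → ℝ) (μ : Measure X) (ν : Measure Y) (f : X → ℝ) : Prop :=
  ∃ g : Y → ℝ, IsDualSolution c μ ν f g

/-- The subdifferential `∂h(z)` in the sense of convex analysis. For convex `h` that is
differentiable at `z` it is `{∇h(z)}` (`subdifferential_eq_gradient`). -/
def subdifferential {d : ℕ} (h : EuclideanSpace ℝ (Fin d) → ℝ)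
    (z : EuclideanSpace ℝ (Fin d)) : Set (EuclideanSpace ℝ (Fin d)) :=
  {p | ∀ w, h z + inner ℝ p (w - z) ≤ h w}

/-- `(∇h)⁻¹(p)`: the point `z` with `p ∈ ∂h(z)`, i.e. with `p = ∇h(z)` when `h` is
differentiable. For strictly convex `h` there is at most one such point
(`gradInv_eq`); if there is none, the value is unspecified. -/
def gradInv {d : ℕ} (h : EuclideanSpace ℝ (Fin d) → ℝ)
    (p : EuclideanSpace ℝ (Fin d)) : EuclideanSpace ℝ (Fin d) :=
  Classical.epsilon fun z => p ∈ subdifferential h z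

/-- At a point of differentiability of a convex function, the subdifferential consists of the
gradient. -/
theorem subdifferential_eq_gradient {d : ℕ} {h : EuclideanSpace ℝ (Fin d) → ℝ}
    (hh : ConvexOn ℝ Set.univ h) {z : EuclideanSpace ℝ (Fin d)} (hz : DifferentiableAt ℝ h z) :
    subdifferential h z = {gradient h z} := by
  have hg : ∀ w, inner ℝ (gradient h z) w = fderiv ℝ h z w := fun w => by
    rw [gradient, InnerProductSpace.toDual_symm_apply]
  ext p
  simp only [subdifferential, Set.mem_ofPred_eq, Set.mem_singleton_iff]
  constructor
  · intro hp
    have hmin : IsLocalMin (fun w => h w - inner ℝ p w) z := by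
      refine Filter.Eventually.of_forall fun w => ?_
      have := hp w
      rw [inner_sub_right] at this
      linarith
    have hd : HasFDerivAt (fun w => h w - inner ℝ p w) (fderiv ℝ h z - innerSL ℝ p) z :=
      hz.hasFDerivAt.sub (innerSL ℝ p).hasFDerivAt
    have h0 := hmin.hasFDerivAt_eq_zero hd
    refine ext_inner_right ℝ fun w => ?_
    have := congrArg (fun L => L w) h0
    simp only [sub_apply, innerSL_apply_apply, zero_apply] at this
    rw [hg]
    linarith
  · rintro rfl w
    rw [hg]
    have hline : HasDerivAt (fun t : ℝ => h (z + t • (w - z))) (fderiv ℝ h z (w - z)) 0 := by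
      have h1 : HasDerivAt (fun t : ℝ => z + t • (w - z)) (w - z) 0 := by
        simpa using ((hasDerivAt_id (0 : ℝ)).smul_const (w - z)).const_add z
      have h2 : HasFDerivAt h (fderiv ℝ h z) (z + (0 : ℝ) • (w - z)) := by
        simpa using hz.hasFDerivAt
      exact h2.comp_hasDerivAt 0 h1
    have hc : ConvexOn ℝ Set.univ (fun t : ℝ => h (z + t • (w - z))) := by
      have := hh.comp_affineMap (AffineMap.lineMap z w : ℝ →ᵃ[ℝ] EuclideanSpace ℝ (Fin d))
      have e : (fun t : ℝ => h (z + t • (w - z))) =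
          h ∘ (AffineMap.lineMap z w : ℝ →ᵃ[ℝ] EuclideanSpace ℝ (Fin d)) := by
        funext t
        simp [AffineMap.lineMap_apply, add_comm]
      rw [e]
      exact this
    have := hc.le_slope_of_hasDerivAt (Set.mem_univ 0) (Set.mem_univ 1) one_pos hline
    simp only [slope_def_field, one_smul, zero_smul, add_zero, sub_zero, div_one,
      add_sub_cancel] at this
    linarith

/-- For strictly convex `h`, the point `z` with `p ∈ ∂h(z)` is unique, so that `gradInv h` is
the inverse of the (sub)gradient map on its range. -/
theorem gradInv_eq {d : ℕ} {h : EuclideanSpace ℝ (Fin d) → ℝ}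
    (hh : StrictConvexOn ℝ Set.univ h) {z p : EuclideanSpace ℝ (Fin d)}
    (hp : p ∈ subdifferential h z) : gradInv h p = z := by
  have hq : p ∈ subdifferential h (gradInv h p) :=
    Classical.epsilon_spec (p := fun z => p ∈ subdifferential h z) ⟨z, hp⟩
  set y := gradInv h p
  by_contra hne
  have hlt := hh.2 (Set.mem_univ y) (Set.mem_univ z) hne
    (by norm_num : (0 : ℝ) < 1 / 2) (by norm_num : (0 : ℝ) < 1 / 2) (by norm_num)
  have h1 := hp ((1 / 2 : ℝ) • y + (1 / 2 : ℝ) • z)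
  have h2 := hq ((1 / 2 : ℝ) • y + (1 / 2 : ℝ) • z)
  simp only [inner_sub_right, inner_add_right, inner_smul_right, smul_eq_mul] at h1 h2 hlt
  linarith

end OptimalTransport

end

/-! Push both marginals forward by the diffeomorphisms, so that the cost becomes `h (x - y)`, and
work on a closed ball. There the dual functional `φ ↦ ∫ φᶜ dμ + ∫ φ dν` has a continuous maximizer:
double `c`-transforms share a modulus of continuity inherited from `c`, so Arzelà–Ascoli applies
(`exists_isMax_dualValue`).

The transform `f = φᶜ` is Lipschitz on the ball, hence differentiable `μ`-a.e. by Rademacher. If `f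
x + φ y = h (x - y)`, then `∇f x ∈ ∂h (x - y)`, and strict convexity determines `y`. So almost every
`x` has a single contact point `T x`. The first variation of the dual functional in the direction
`ψ` is `∫ ψ dν - ∫ ψ ∘ T dμ`; its vanishing at the maximizer says that `T` transports `μ` to `ν`
(`map_eq_of_isMax`).

The plan on the graph of `T` lies in the contact set, so primal and dual values agree and both are
optimal. Any other optimal plan has zero slack, so it lives on the same graph and is the same plan
(`isOptimalPlan_and_unique`). -/

noncomputable section

namespace OptimalTransport

open Filter Topology

/-! ### The `c`-transform on a compact factor. -/

section Transform

variable {X Y : Type*} {c : X → Y → ℝ} {φ ψ : Y → ℝ} {x : X}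

/-- The `c`-transform of a function `φ` on the second factor. -/
def cTransform (c : X → Y → ℝ) (φ : Y → ℝ) (x : X) : ℝ :=
  ⨅ y, (c x y - φ y)

variable [TopologicalSpace Y] [CompactSpace Y]

theorem cTransform_add_le (hc : Continuous (c x)) (hφ : Continuous φ) (y : Y) :
    cTransform c φ x + φ y ≤ c x y := by
  have : cTransform c φ x ≤ c x y - φ y :=
    ciInf_le (isCompact_range (hc.sub hφ)).bddBelow y
  linarith

theorem exists_cTransform_add_eq [Nonempty Y] (hc : Continuous (c x)) (hφ : Continuous φ) :
    ∃ y, cTransform c φ x + φ y = c x y := by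
  obtain ⟨y, -, hy⟩ := isCompact_univ.exists_isMinOn Set.univ_nonempty (hc.sub hφ).continuousOn
  refine ⟨y, le_antisymm (cTransform_add_le hc hφ y) ?_⟩
  have : c x y - φ y ≤ cTransform c φ x := le_ciInf fun y' => hy (Set.mem_univ y')
  linarith

theorem continuous_cTransform [TopologicalSpace X] (hc : Continuous (Function.uncurry c)) (hφ : Continuous φ) :
    Continuous (cTransform c φ) := by
  have := isCompact_univ.continuous_sInf (f := fun x y => c x y - φ y) (K := Set.univ)
    (hc.sub (hφ.comp continuous_snd))
  simp only [Set.image_univ, sInf_range] at this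
  exact this

theorem cTransform_le_add [Nonempty Y] (hc : Continuous (c x)) (hφ : Continuous φ)
    (hψ : Continuous ψ) {r : ℝ} (hr : ∀ y, φ y ≤ ψ y + r) :
    cTransform c ψ x ≤ cTransform c φ x + r := by
  obtain ⟨y, hy⟩ := exists_cTransform_add_eq hc hφ
  have := cTransform_add_le hc hψ y
  linarith [hr y]

theorem cTransform_sub_const [Nonempty Y] (hc : Continuous (c x)) (hφ : Continuous φ) (r : ℝ) :
    cTransform c (fun y => φ y - r) x = cTransform c φ x + r := by
  apply le_antisymm
  · exact cTransform_le_add hc hφ (by fun_prop) (by simp)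
  · have := cTransform_le_add hc (φ := fun y => φ y - r) (by fun_prop) hφ (r := -r)
      (fun y => by linarith)
    linarith

end Transform

/-- The modulus of `c` in `y`, uniform in `x`, passes to every transform whatever `f` is; this is
the source of equicontinuity. -/
theorem cTransform_swap_sub_le {X Y : Type*} [TopologicalSpace X] [TopologicalSpace Y]
    [CompactSpace X] [Nonempty X] {c : X → Y → ℝ}
    (hc : Continuous (Function.uncurry c)) {f : X → ℝ} (hf : Continuous f) {r : ℝ} {y y' : Y}
    (hr : ∀ x, c x y ≤ c x y' + r) :
    cTransform (flip c) f y - cTransform (flip c) f y' ≤ r := by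
  have hc' : ∀ y, Continuous (flip c y) := fun y => hc.comp (by fun_prop : Continuous fun x => (x, y))
  obtain ⟨x, hx⟩ := exists_cTransform_add_eq (hc' y') hf
  have := cTransform_add_le (hc' y) hf x
  simp only [flip] at *
  linarith [hr x]

/-- Potentials with a fixed modulus of continuity that vanish at a given point form a compact
set. -/
theorem isCompact_setOf_modulus {Y : Type*} [TopologicalSpace Y] {ω : Y → Y → ℝ} (hω : Continuous (Function.uncurry ω))
    (hω0 : ∀ y, ω y y = 0) (y₀ : Y) :
    IsCompact {φ : C(Y, ℝ) | φ y₀ = 0 ∧ ∀ y y', φ y - φ y' ≤ ω y y'} := by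
  have hclosed : IsClosed {φ : Y → ℝ | φ y₀ = 0 ∧ ∀ y y', φ y - φ y' ≤ ω y y'} := by
    simp only [Set.ofPred_and, Set.ofPred_forall]
    refine (isClosed_eq (continuous_apply _) continuous_const).inter
      (isClosed_iInter fun y => isClosed_iInter fun y' => ?_)
    exact isClosed_le (by fun_prop) continuous_const
  -- Continuity is automatic from the modulus, so the pointwise-closed set below is exactly the
  -- image of the set of continuous potentials.
  have hcont : ∀ φ : Y → ℝ, (∀ y y', φ y - φ y' ≤ ω y y') → Continuous φ := by
    intro φ hφ
    refine continuous_iff_continuousAt.2 fun y => ?_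
    have l₁ : Tendsto (fun z => φ y - ω y z) (𝓝 y) (𝓝 (φ y)) := by
      have : Continuous fun z => φ y - ω y z :=
        continuous_const.sub (hω.comp (by fun_prop : Continuous fun z => (y, z)))
      simpa [hω0] using this.tendsto y
    have l₂ : Tendsto (fun z => φ y + ω z y) (𝓝 y) (𝓝 (φ y)) := by
      have : Continuous fun z => φ y + ω z y :=
        continuous_const.add (hω.comp (by fun_prop : Continuous fun z => (z, y)))
      simpa [hω0] using this.tendsto y
    exact tendsto_of_tendsto_of_tendsto_of_le_of_le l₁ l₂
      (fun z => by linarith [hφ y z]) (fun z => by linarith [hφ z y])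
  refine ArzelaAscoli.isCompact_of_equicontinuous _ ?_ ?_
  · have : ContinuousMap.toFun '' {φ : C(Y, ℝ) | φ y₀ = 0 ∧ ∀ y y', φ y - φ y' ≤ ω y y'} =
        {φ : Y → ℝ | φ y₀ = 0 ∧ ∀ y y', φ y - φ y' ≤ ω y y'} := by
      ext φ
      constructor
      · rintro ⟨φ, hφ, rfl⟩
        exact hφ
      · intro hφ
        exact ⟨⟨φ, hcont φ hφ.2⟩, hφ, rfl⟩
    rw [this]
    refine (isCompact_univ_pi fun y => isCompact_Icc (a := -ω y₀ y) (b := ω y y₀)).of_isClosed_subset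
      hclosed fun φ hφ y _ => ⟨?_, ?_⟩
    · linarith [hφ.2 y₀ y, hφ.1]
    · linarith [hφ.2 y y₀, hφ.1]
  · intro y
    rw [Metric.equicontinuousAt_iff_right]
    intro ε hε
    have l₁ : ∀ᶠ z in 𝓝 y, ω y z < ε := by
      have : Continuous fun z => ω y z := hω.comp (by fun_prop : Continuous fun z => (y, z))
      exact this.continuousAt.eventually_lt_const (by simpa [hω0])
    have l₂ : ∀ᶠ z in 𝓝 y, ω z y < ε := by
      have : Continuous fun z => ω z y := hω.comp (by fun_prop : Continuous fun z => (z, y))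
      exact this.continuousAt.eventually_lt_const (by simpa [hω0])
    filter_upwards [l₁, l₂] with z h₁ h₂ φ
    rw [Real.dist_eq, abs_lt]
    constructor
    · linarith [φ.2.2 z y]
    · linarith [φ.2.2 y z]

/-! ### Existence of a maximizer of the dual functional. -/

section Dual

variable {X Y : Type*} [TopologicalSpace X] [TopologicalSpace Y] [CompactSpace X] [CompactSpace Y]
  [MeasurableSpace X] [BorelSpace X] [MeasurableSpace Y] [BorelSpace Y]
  (μ : Measure X) (ν : Measure Y) [IsProbabilityMeasure μ] [IsProbabilityMeasure ν]
  {c : X → Y → ℝ}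

/-- The dual Kantorovich functional of a single continuous potential. -/
def dualValue (c : X → Y → ℝ) (φ : Y → ℝ) : ℝ :=
  ∫ x, cTransform c φ x ∂μ + ∫ y, φ y ∂ν

theorem integrable_of_continuous {f : X → ℝ} (hf : Continuous f) : Integrable f μ :=
  hf.integrable_of_hasCompactSupport (.of_compactSpace f)

theorem dualValue_le_add (hc : Continuous (Function.uncurry c)) {φ ψ : Y → ℝ}
    (hφ : Continuous φ) (hψ : Continuous ψ) {r : ℝ} (h₁ : ∀ y, φ y ≤ ψ y + r)
    (h₂ : ∀ y, ψ y ≤ φ y + r) : dualValue μ ν c φ ≤ dualValue μ ν c ψ + 2 * r := by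
  have : Nonempty Y := nonempty_of_isProbabilityMeasure ν
  have hcx : ∀ x, Continuous (c x) := fun x => hc.comp (by fun_prop : Continuous fun y => (x, y))
  have hI := integrable_of_continuous μ (continuous_cTransform hc hφ)
  have hI' := integrable_of_continuous μ (continuous_cTransform hc hψ)
  have e₁ : ∫ x, cTransform c φ x ∂μ ≤ ∫ x, (cTransform c ψ x + r) ∂μ :=
    integral_mono hI (hI'.add (integrable_const r))
      fun x => cTransform_le_add (hcx x) hψ hφ h₂
  have e₂ : ∫ y, φ y ∂ν ≤ ∫ y, (ψ y + r) ∂ν :=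
    integral_mono (integrable_of_continuous ν hφ)
      ((integrable_of_continuous ν hψ).add (integrable_const r)) h₁
  rw [integral_add hI' (integrable_const r)] at e₁
  rw [integral_add (integrable_of_continuous ν hψ) (integrable_const r)] at e₂
  simp only [integral_const, probReal_univ, one_smul] at e₁ e₂
  simp only [dualValue]
  linarith

theorem dualValue_sub_const (hc : Continuous (Function.uncurry c)) {φ : Y → ℝ}
    (hφ : Continuous φ) (r : ℝ) :
    dualValue μ ν c (fun y => φ y - r) = dualValue μ ν c φ := by
  have : Nonempty Y := nonempty_of_isProbabilityMeasure ν
  have hcx : ∀ x, Continuous (c x) := fun x => hc.comp (by fun_prop : Continuous fun y => (x, y))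
  have hI := integrable_of_continuous μ (continuous_cTransform hc hφ)
  simp only [dualValue, cTransform_sub_const (hcx _) hφ]
  rw [integral_add hI (integrable_const r),
    integral_sub (integrable_of_continuous ν hφ) (integrable_const r)]
  simp

/-- Transforming twice can only raise `φ`, and the third transform is no smaller than the first, so
both integrals increase. -/
theorem dualValue_le_cTransform_cTransform (hc : Continuous (Function.uncurry c)) {φ : Y → ℝ}
    (hφ : Continuous φ) :
    dualValue μ ν c φ ≤ dualValue μ ν c (cTransform (flip c) (cTransform c φ)) := by
  have : Nonempty Y := nonempty_of_isProbabilityMeasure ν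
  have : Nonempty X := nonempty_of_isProbabilityMeasure μ
  have hcx : ∀ x, Continuous (c x) := fun x => hc.comp (by fun_prop : Continuous fun y => (x, y))
  have hcy : ∀ y, Continuous (flip c y) :=
    fun y => hc.comp (by fun_prop : Continuous fun x => (x, y))
  have hc' : Continuous (Function.uncurry (flip c)) := hc.comp continuous_swap
  have h₁ := continuous_cTransform hc hφ
  have h₂ := continuous_cTransform hc' h₁
  have h₃ := continuous_cTransform hc h₂
  refine add_le_add (integral_mono (integrable_of_continuous μ h₁)
    (integrable_of_continuous μ h₃) fun x => ?_) (integral_mono (integrable_of_continuous ν hφ)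
    (integrable_of_continuous ν h₂) fun y => ?_)
  · refine le_ciInf fun y => ?_
    have := cTransform_add_le (hcy y) h₁ x
    simp only [flip] at this
    linarith
  · refine le_ciInf fun x => ?_
    have := cTransform_add_le (hcx x) hφ y
    simp only [flip]
    linarith

/-- The dual functional attains its maximum over the continuous potentials. -/
theorem exists_isMax_dualValue (hc : Continuous (Function.uncurry c)) :
    ∃ φ : Y → ℝ, Continuous φ ∧ ∀ ψ : Y → ℝ, Continuous ψ →
      dualValue μ ν c ψ ≤ dualValue μ ν c φ := by
  have : Nonempty Y := nonempty_of_isProbabilityMeasure ν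
  have : Nonempty X := nonempty_of_isProbabilityMeasure μ
  obtain ⟨y₀⟩ := ‹Nonempty Y›
  let C : C(Y, C(X, ℝ)) := ContinuousMap.curry ⟨fun p : Y × X => c p.2 p.1, hc.comp continuous_swap⟩
  -- The sup distance between `c · y` and `c · y'`.
  let ω : Y → Y → ℝ := fun y y' => dist (C y) (C y')
  have hω : Continuous (Function.uncurry ω) := by
    simp only [Function.uncurry_def, ω]
    fun_prop
  have hcω : ∀ x y y', c x y ≤ c x y' + ω y y' := by
    intro x y y'
    have := (le_abs_self _).trans (ContinuousMap.dist_apply_le_dist (f := C y) (g := C y') x)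
    change c x y - c x y' ≤ ω y y' at this
    linarith
  let S : Set C(Y, ℝ) := {φ | φ y₀ = 0 ∧ ∀ y y', φ y - φ y' ≤ ω y y'}
  have hS : IsCompact S := isCompact_setOf_modulus hω (fun y => dist_self _) y₀
  have hne : S.Nonempty := ⟨0, rfl, fun y y' => by simp [ω]⟩
  have hJ : LipschitzWith 2 fun φ : C(Y, ℝ) => dualValue μ ν c φ := by
    refine LipschitzWith.of_le_add_mul 2 fun φ ψ => ?_
    refine dualValue_le_add μ ν hc φ.continuous ψ.continuous (fun y => ?_) fun y => ?_
    · have := (le_abs_self _).trans (ContinuousMap.dist_apply_le_dist (f := φ) (g := ψ) y)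
      linarith
    · have := (neg_le_abs _).trans (ContinuousMap.dist_apply_le_dist (f := φ) (g := ψ) y)
      linarith
  obtain ⟨φ, hφS, hφ⟩ := hS.exists_isMaxOn hne hJ.continuous.continuousOn
  refine ⟨φ, φ.continuous, fun ψ hψ => (dualValue_le_cTransform_cTransform μ ν hc hψ).trans ?_⟩
  have hc' : Continuous (Function.uncurry (flip c)) := hc.comp continuous_swap
  have h₁ := continuous_cTransform hc hψ
  have h₂ := continuous_cTransform hc' h₁
  set g := cTransform (flip c) (cTransform c ψ)
  -- Subtracting `g y₀` puts the double transform into `S` at no cost in dual value.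
  rw [← dualValue_sub_const μ ν hc h₂ (g y₀)]
  refine hφ (a := ⟨fun y => g y - g y₀, by fun_prop⟩) ⟨by simp, fun y y' => ?_⟩
  have := cTransform_swap_sub_le hc h₁ (fun x => hcω x y y')
  simpa using this

end Dual

/-! ### The contact map and the first variation. -/

section Pushforward

variable {X Y : Type*} [TopologicalSpace X] [TopologicalSpace Y] [CompactSpace Y]
  {c : X → Y → ℝ} {φ : Y → ℝ}

/-- Almost minimizers of the `c`-transform converge to the minimizer if that is unique. -/
theorem tendsto_of_tendsto_cTransform {ι : Type*} {l : Filter ι}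
    (hc : Continuous (Function.uncurry c)) (hφ : Continuous φ) {x : X} {y : Y} {u : ι → X}
    {v : ι → Y} (hu : Tendsto u l (𝓝 x))
    (hv : Tendsto (fun i => cTransform c φ (u i) + φ (v i) - c (u i) (v i)) l (𝓝 0))
    (huniq : ∀ y', cTransform c φ x + φ y' = c x y' → y' = y) :
    Tendsto v l (𝓝 y) := by
  -- By compactness of `Y` it suffices to identify cluster points, and continuity of the slack makes
  -- each of them a contact point of `x`.
  refine tendsto_nhds_of_unique_mapClusterPt fun y' hy' => huniq y' ?_
  obtain ⟨U, hU, hUv⟩ := mapClusterPt_iff_ultrafilter.1 hy'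
  have h₁ : Tendsto (fun i => (u i, v i)) U (𝓝 (x, y')) := (hu.mono_left hU).prodMk_nhds hUv
  have h₂ : Continuous fun p : X × Y => cTransform c φ p.1 + φ p.2 - c p.1 p.2 :=
    (((continuous_cTransform hc hφ).comp continuous_fst).add (hφ.comp continuous_snd)).sub hc
  have := tendsto_nhds_unique ((h₂.tendsto _).comp h₁) (hv.mono_left hU)
  simp only at this
  linarith

variable [MeasurableSpace X] [BorelSpace X] [MeasurableSpace Y] [BorelSpace Y]
  {μ : Measure X} {ν : Measure Y}

/-- No measurable selection is needed: any choice of contact points is continuous on the set where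
the contact point is unique. -/
theorem aemeasurable_of_cTransform_add_eq (hc : Continuous (Function.uncurry c))
    (hφ : Continuous φ)
    (huniq : ∀ᵐ x ∂μ, ∀ y y', cTransform c φ x + φ y = c x y →
      cTransform c φ x + φ y' = c x y' → y = y')
    {T : X → Y} (hT : ∀ x, cTransform c φ x + φ (T x) = c x (T x)) : AEMeasurable T μ := by
  -- A measurable set of full measure inside the uniqueness set, which is not known to be
  -- measurable.
  set D : Set X := (toMeasurable μ {x | ∀ y y', cTransform c φ x + φ y = c x y →
      cTransform c φ x + φ y' = c x y' → y = y'}ᶜ)ᶜ with hD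
  have hDm : MeasurableSet D := (measurableSet_toMeasurable _ _).compl
  have hDμ : μ.restrict D = μ := by
    refine Measure.restrict_eq_self_of_ae_mem ?_
    rw [ae_iff]
    have : {a | a ∉ D} = toMeasurable μ {x | ∀ y y', cTransform c φ x + φ y = c x y →
      cTransform c φ x + φ y' = c x y' → y = y'}ᶜ := by
      ext a
      simp [hD]
    rw [this, measure_toMeasurable]
    exact huniq
  have hDu : ∀ x ∈ D, ∀ y y', cTransform c φ x + φ y = c x y →
      cTransform c φ x + φ y' = c x y' → y = y' := by
    intro x hx
    by_contra hx'
    exact hx (subset_toMeasurable _ _ hx')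
  rw [← hDμ]
  refine ContinuousOn.aemeasurable (fun x hx => ?_) hDm
  refine tendsto_of_tendsto_cTransform hc hφ (u := id) (tendsto_id.mono_left nhdsWithin_le_nhds)
    ?_ fun y' hy' => hDu x hx _ _ hy' (hT x)
  simpa [hT] using tendsto_const_nhds

variable [CompactSpace X] [IsProbabilityMeasure μ] [IsProbabilityMeasure ν]

/-- The one-sided first variation of the dual functional at a maximizer. -/
theorem integral_comp_le_of_isMax (hc : Continuous (Function.uncurry c)) (hφ : Continuous φ)
    (hmax : ∀ ψ : Y → ℝ, Continuous ψ → dualValue μ ν c ψ ≤ dualValue μ ν c φ)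
    (huniq : ∀ᵐ x ∂μ, ∀ y y', cTransform c φ x + φ y = c x y →
      cTransform c φ x + φ y' = c x y' → y = y')
    {T : X → Y} (hT : ∀ x, cTransform c φ x + φ (T x) = c x (T x))
    {ψ : Y → ℝ} (hψ : Continuous ψ) :
    ∫ y, ψ y ∂ν ≤ ∫ x, ψ (T x) ∂μ := by
  have : Nonempty Y := nonempty_of_isProbabilityMeasure ν
  have hcx : ∀ x, Continuous (c x) := fun x => hc.comp (by fun_prop : Continuous fun y => (x, y))
  obtain ⟨M, hM⟩ : ∃ M, ∀ y, |ψ y| ≤ M := by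
    obtain ⟨M, hM⟩ := (isCompact_range hψ).isBounded.exists_norm_le
    exact ⟨M, fun y => hM _ ⟨y, rfl⟩⟩
  let ε : ℕ → ℝ := fun n => 1 / ((n : ℝ) + 1)
  have hε : ∀ n, 0 < ε n := fun n => Nat.one_div_pos_of_nat
  have hε0 : Tendsto ε atTop (𝓝 0) := tendsto_one_div_add_atTop_nhds_zero_nat
  let φn : ℕ → Y → ℝ := fun n y => φ y + ε n * ψ y
  have hφn : ∀ n, Continuous (φn n) := fun n => by fun_prop
  choose v hv using fun n x => exists_cTransform_add_eq (hcx x) (hφn n)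
  let q : ℕ → X → ℝ := fun n x => (cTransform c (φn n) x - cTransform c φ x) / ε n
  have hqc : ∀ n, Continuous (q n) := fun n =>
    ((continuous_cTransform hc (hφn n)).sub (continuous_cTransform hc hφ)).div_const _
  -- The difference quotient is squeezed by testing the perturbed transform at the old contact point
  -- and the old transform at the new one.
  have hq_le : ∀ n x, q n x ≤ -ψ (T x) := by
    intro n x
    rw [div_le_iff₀ (hε n)]
    have := cTransform_add_le (hcx x) (hφn n) (T x)
    simp only [φn] at this
    linarith [hT x]
  have hle_q : ∀ n x, -ψ (v n x) ≤ q n x := by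
    intro n x
    rw [le_div_iff₀ (hε n)]
    have := cTransform_add_le (hcx x) hφ (v n x)
    have h' := hv n x
    simp only [φn] at h'
    linarith
  have hlim : ∀ᵐ x ∂μ, Tendsto (fun n => q n x) atTop (𝓝 (-ψ (T x))) := by
    filter_upwards [huniq] with x hx
    have hvT : Tendsto (fun n => v n x) atTop (𝓝 (T x)) := by
      refine tendsto_of_tendsto_cTransform hc hφ (u := fun _ => x) tendsto_const_nhds ?_
        fun y' hy' => hx _ _ hy' (hT x)
      -- The slack of `φ` at `v n x` is at least `-2 * M * ε n`: one `M * ε n` for the change of the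
      -- transform, one for the term `ε n * ψ (v n x)`.
      have hl : Tendsto (fun n => -(2 * M) * ε n) atTop (𝓝 0) := by
        simpa using hε0.const_mul (-(2 * M))
      refine tendsto_of_tendsto_of_tendsto_of_le_of_le hl tendsto_const_nhds (fun n => ?_)
        fun n => ?_
      · have h₁ := hle_q n x
        have h₂ := hq_le n x
        have h₃ : -M ≤ q n x := by linarith [le_abs_self (ψ (v n x)), hM (v n x)]
        rw [le_div_iff₀ (hε n)] at h₃
        have h₄ := hv n x
        simp only [φn] at h₄
        have h₅ : ε n * ψ (v n x) ≤ ε n * M :=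
          mul_le_mul_of_nonneg_left ((le_abs_self _).trans (hM _)) (hε n).le
        have h₆ := cTransform_le_add (hcx x) hφ (hφn n) (r := ε n * M) fun y => by
          have : ε n * -ψ y ≤ ε n * M :=
            mul_le_mul_of_nonneg_left ((neg_le_abs _).trans (hM _)) (hε n).le
          simp only [φn]
          linarith
        simp only
        linarith
      · linarith [cTransform_add_le (hcx x) hφ (v n x)]
    exact tendsto_of_tendsto_of_tendsto_of_le_of_le ((hψ.tendsto _).comp hvT).neg
      tendsto_const_nhds (fun n => hle_q n x) fun n => hq_le n x
  have hint : Tendsto (fun n => ∫ x, q n x ∂μ) atTop (𝓝 (∫ x, -ψ (T x) ∂μ)) := by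
    refine tendsto_integral_of_dominated_convergence (fun _ => M)
      (fun n => (hqc n).aestronglyMeasurable) (integrable_const M) (fun n => ?_) hlim
    refine .of_forall fun x => ?_
    rw [Real.norm_eq_abs, abs_le]
    constructor
    · linarith [hle_q n x, le_abs_self (ψ (v n x)), hM (v n x)]
    · linarith [hq_le n x, neg_le_abs (ψ (T x)), hM (T x)]
  have hbound : ∀ n, ∫ x, q n x ∂μ ≤ -∫ y, ψ y ∂ν := by
    intro n
    have h₁ := hmax (φn n) (hφn n)
    have i₁ := integrable_of_continuous μ (continuous_cTransform hc (hφn n))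
    have i₂ := integrable_of_continuous μ (continuous_cTransform hc hφ)
    have i₃ := integrable_of_continuous ν hφ
    have i₄ := integrable_of_continuous ν hψ
    have h₂ : ∫ y, φn n y ∂ν = ∫ y, φ y ∂ν + ε n * ∫ y, ψ y ∂ν := by
      rw [← integral_const_mul, ← integral_add i₃ (i₄.const_mul _)]
    simp only [dualValue, h₂] at h₁
    simp only [q]
    rw [integral_div, integral_sub i₁ i₂, div_le_iff₀ (hε n)]
    linarith
  have := le_of_tendsto' hint hbound
  rw [integral_neg] at this
  linarith

/-- At a maximizer of the dual functional, the map that sends a point to its unique contact point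
pushes the first marginal to the second one. -/
theorem map_eq_of_isMax [HasOuterApproxClosed Y] (hc : Continuous (Function.uncurry c))
    (hφ : Continuous φ)
    (hmax : ∀ ψ : Y → ℝ, Continuous ψ → dualValue μ ν c ψ ≤ dualValue μ ν c φ)
    (huniq : ∀ᵐ x ∂μ, ∀ y y', cTransform c φ x + φ y = c x y →
      cTransform c φ x + φ y' = c x y' → y = y')
    {T : X → Y} (hT : ∀ x, cTransform c φ x + φ (T x) = c x (T x)) : μ.map T = ν := by
  have hTm := aemeasurable_of_cTransform_add_eq hc hφ huniq hT
  have : IsProbabilityMeasure (μ.map T) := Measure.isProbabilityMeasure_map hTm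
  refine ext_of_forall_integral_eq_of_IsFiniteMeasure fun ψ => ?_
  rw [integral_map hTm ψ.continuous.aestronglyMeasurable]
  refine le_antisymm ?_ (integral_comp_le_of_isMax hc hφ hmax huniq hT ψ.continuous)
  -- Testing with `-ψ` turns the one-sided inequality into equality.
  have := integral_comp_le_of_isMax hc hφ hmax huniq hT ψ.continuous.neg
  simpa [integral_neg] using this

end Pushforward

/-! ### Weak duality for couplings. -/

section WeakDuality

variable {X Y : Type*} [MeasurableSpace X] [MeasurableSpace Y] {μ : Measure X} {ν : Measure Y}
  {π : Measure (X × Y)} {c : X → Y → ℝ} {f : X → ℝ} {g : Y → ℝ}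

/-- For a continuous cost, a dual constraint that holds almost everywhere for the product measure
holds on a product of sets of full measure. -/
theorem exists_add_le_of_ae_prod [TopologicalSpace Y] [SecondCountableTopology Y] [SFinite μ]
    [SFinite ν] (hc : ∀ x, Continuous (c x))
    (hfg : ∀ᵐ p ∂μ.prod ν, f p.1 + g p.2 ≤ c p.1 p.2) :
    ∃ G : Set Y, (∀ᵐ y ∂ν, y ∈ G) ∧ ∀ᵐ x ∂μ, ∀ y ∈ G, f x + g y ≤ c x y := by
  have hG : ∀ᵐ y ∂ν, ∀ᵐ x ∂μ, f x + g y ≤ c x y := by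
    rw [← Measure.prod_swap] at hfg
    exact Measure.ae_ae_of_ae_prod (ae_of_ae_map measurable_swap.aemeasurable hfg)
  refine ⟨{y | ∀ᵐ x ∂μ, f x + g y ≤ c x y}, hG, ?_⟩
  -- The exceptional null set of `x` depends on `y`. Since `g` need not be continuous, the countable
  -- dense set is taken in its graph, where the constraint is closed in `(y, g y)`.
  let S : Set (Y × ℝ) := (fun y => (y, g y)) '' {y | ∀ᵐ x ∂μ, f x + g y ≤ c x y}
  obtain ⟨D, hDc, hD⟩ := TopologicalSpace.exists_countable_dense S
  have hDae : ∀ᵐ x ∂μ, ∀ s ∈ D, f x + s.1.2 ≤ c x s.1.1 := by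
    rw [ae_ball_iff hDc]
    rintro ⟨_, y, hy, rfl⟩ -
    exact hy
  filter_upwards [hDae] with x hx y hy
  have hcl : IsClosed {s : S | f x + s.1.2 ≤ c x s.1.1} :=
    isClosed_le (by fun_prop) ((hc x).comp (by fun_prop))
  have := closure_minimal hx hcl
  rw [hD.closure_eq] at this
  exact this (Set.mem_univ ⟨_, y, hy, rfl⟩)

theorem IsCoupling.integrable_add (hπ : IsCoupling μ ν π) (hf : Integrable f μ)
    (hg : Integrable g ν) : Integrable (fun p : X × Y => f p.1 + g p.2) π := by
  obtain ⟨rfl, rfl⟩ := hπ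
  exact (hf.comp_measurable measurable_fst).add (hg.comp_measurable measurable_snd)

theorem IsCoupling.integral_add (hπ : IsCoupling μ ν π) (hf : Integrable f μ)
    (hg : Integrable g ν) : ∫ p, (f p.1 + g p.2) ∂π = ∫ x, f x ∂μ + ∫ y, g y ∂ν := by
  obtain ⟨rfl, rfl⟩ := hπ
  rw [integral_map measurable_fst.aemeasurable hf.1, integral_map measurable_snd.aemeasurable hg.1]
  exact MeasureTheory.integral_add (hf.comp_measurable measurable_fst)
    (hg.comp_measurable measurable_snd)

theorem IsCoupling.ae_fst (hπ : IsCoupling μ ν π) {P : X → Prop} (h : ∀ᵐ x ∂μ, P x) :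
    ∀ᵐ p ∂π, P p.1 := by
  obtain ⟨rfl, rfl⟩ := hπ
  exact ae_of_ae_map measurable_fst.aemeasurable h

theorem IsCoupling.ae_snd (hπ : IsCoupling μ ν π) {P : Y → Prop} (h : ∀ᵐ y ∂ν, P y) :
    ∀ᵐ p ∂π, P p.2 := by
  obtain ⟨rfl, rfl⟩ := hπ
  exact ae_of_ae_map measurable_snd.aemeasurable h

theorem IsCoupling.isProbabilityMeasure [IsProbabilityMeasure μ] (hπ : IsCoupling μ ν π) :
    IsProbabilityMeasure π := by
  refine ⟨?_⟩
  rw [← Set.preimage_univ (f := Prod.fst), ← Measure.map_apply measurable_fst .univ, hπ.1]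
  exact measure_univ

/-- A coupling that is concentrated on the contact set of an admissible pair is optimal for the
Kantorovich problem, and the pair is optimal for the dual problem. -/
theorem IsDualAdmissible.isDualSolution [TopologicalSpace Y] [SecondCountableTopology Y]
    [SFinite μ] [SFinite ν] (hc : ∀ x, Continuous (c x)) (h : IsDualAdmissible c μ ν f g)
    (hπ : IsCoupling μ ν π) (heq : ∀ᵐ p ∂π, f p.1 + g p.2 = c p.1 p.2) :
    IsDualSolution c μ ν f g := by
  refine ⟨h, fun f' g' h' => ?_⟩
  rw [← hπ.integral_add h.1 h.2.1, ← hπ.integral_add h'.1 h'.2.1]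
  refine integral_mono_ae (hπ.integrable_add h'.1 h'.2.1) (hπ.integrable_add h.1 h.2.1) ?_
  obtain ⟨G, hG, hle⟩ := exists_add_le_of_ae_prod hc h'.2.2
  filter_upwards [heq, hπ.ae_fst hle, hπ.ae_snd hG] with p h₁ h₂ h₃
  rw [h₁]
  exact h₂ _ h₃

end WeakDuality

/-! ### Subgradients of the cost at contact points. -/

section Gradient

variable {d : ℕ} {h f : EuclideanSpace ℝ (Fin d) → ℝ} {x y : EuclideanSpace ℝ (Fin d)}

/-- Since `f` touches `h (· - y) - b` from below at `x`, convexity bounds its one-sided slope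
towards `w` by `h w - h (x - y)`; `h` itself need not be differentiable. -/
theorem gradient_mem_subdifferential (hh : ConvexOn ℝ Set.univ h) (hf : DifferentiableAt ℝ f x)
    {b : ℝ} (hle : ∀ x', f x' + b ≤ h (x' - y)) (heq : f x + b = h (x - y)) :
    gradient f x ∈ subdifferential h (x - y) := by
  intro w
  rw [gradient, InnerProductSpace.toDual_symm_apply]
  set v := w - (x - y) with hv
  have hline : HasDerivAt (fun t : ℝ => f (x + t • v)) (fderiv ℝ f x v) 0 := by
    have h1 : HasDerivAt (fun t : ℝ => x + t • v) v 0 := by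
      simpa using ((hasDerivAt_id (0 : ℝ)).smul_const v).const_add x
    have h2 : HasFDerivAt f (fderiv ℝ f x) (x + (0 : ℝ) • v) := by
      simpa using hf.hasFDerivAt
    exact h2.comp_hasDerivAt 0 h1
  have hslope := hline.tendsto_slope_zero_right
  have hbound : ∀ᶠ t : ℝ in 𝓝[>] 0, t⁻¹ • (f (x + (0 + t) • v) - f (x + (0 : ℝ) • v)) ≤
      h w - h (x - y) := by
    filter_upwards [Ioo_mem_nhdsGT (zero_lt_one (α := ℝ))] with t ht
    have hconv := hh.2 (Set.mem_univ (x - y)) (Set.mem_univ w) (sub_nonneg.2 ht.2.le) ht.1.le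
      (by ring)
    have e : (1 - t) • (x - y) + t • w = x + t • v - y := by
      rw [hv]
      module
    rw [e] at hconv
    have := hle (x + t • v)
    simp only [smul_eq_mul, zero_add, zero_smul, add_zero] at hconv ⊢
    rw [inv_mul_le_iff₀ ht.1]
    linarith
  have := le_of_tendsto hslope hbound
  linarith

end Gradient

open Metric

/-! ### Convex costs on Euclidean space. -/

section Euclidean

variable {d : ℕ} {h : EuclideanSpace ℝ (Fin d) → ℝ}

theorem lipschitzOnWith_cTransform_sub {K : Set (EuclideanSpace ℝ (Fin d))} [CompactSpace K]
    [Nonempty K] {s : Set (EuclideanSpace ℝ (Fin d))} {C : NNReal} {t : Set _}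
    (hc : Continuous h) (hC : LipschitzOnWith C h t) (hst : ∀ x ∈ s, ∀ y ∈ K, x - y ∈ t)
    {φ : K → ℝ} (hφ : Continuous φ) :
    LipschitzOnWith C (cTransform (fun x (y : K) => h (x - y)) φ) s := by
  have hcx : ∀ x, Continuous fun y : K => h (x - y) := fun x => by fun_prop
  refine LipschitzOnWith.of_le_add_mul C fun x hx x' hx' => ?_
  obtain ⟨y, hy⟩ := exists_cTransform_add_eq (c := fun x (y : K) => h (x - y)) (hcx x') hφ
  have h₁ := cTransform_add_le (c := fun x (y : K) => h (x - y)) (hcx x) hφ y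
  have h₂ := hC.le_add_mul (hst x hx y y.2) (hst x' hx' y y.2)
  rw [dist_sub_right] at h₂
  linarith

/-- A convex function is Lipschitz on compact sets, the transform inherits the constant, and
Rademacher's theorem applies. -/
theorem ae_differentiableAt_cTransform_sub (hh : ConvexOn ℝ Set.univ h)
    {K : Set (EuclideanSpace ℝ (Fin d))} (hK : IsCompact K) [Nonempty K] {R : ℝ}
    {φ : K → ℝ} (hφ : Continuous φ) :
    ∀ᵐ x, x ∈ ball 0 R →
      DifferentiableAt ℝ (cTransform (fun x (y : K) => h (x - y)) φ) x := by
  have : CompactSpace K := isCompact_iff_compactSpace.1 hK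
  have hL := hh.locallyLipschitz
  obtain ⟨C, hC⟩ := hL.locallyLipschitzOn.exists_lipschitzOnWith_of_compact
    (((isCompact_closedBall (0 : EuclideanSpace ℝ (Fin d)) R).prod hK).image continuous_sub)
  have hf := lipschitzOnWith_cTransform_sub (s := ball 0 R) hL.continuous hC
    (fun x hx y hy => ⟨(x, y), ⟨ball_subset_closedBall hx, hy⟩, rfl⟩) hφ
  have := hf.ae_differentiableWithinAt (μ := volume) measurableSet_ball
  rw [ae_restrict_iff' measurableSet_ball] at this
  filter_upwards [this] with x hx hxR
  exact (hx hxR).differentiableAt (isOpen_ball.mem_nhds hxR)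

/-- For compactly supported marginals the first of which is absolutely continuous, and a strictly
convex translation-invariant cost, there are a pair of dual potentials and a transport map whose
graph lies in their contact set. -/
theorem exists_potentials_and_map (hh : StrictConvexOn ℝ Set.univ h)
    (μ ν : Measure (EuclideanSpace ℝ (Fin d))) [IsProbabilityMeasure μ] [IsProbabilityMeasure ν]
    (hμ : μ ≪ volume) {R : ℝ} (hμR : ∀ᵐ x ∂μ, x ∈ ball 0 R) (hνR : ∀ᵐ y ∂ν, y ∈ ball 0 R) :
    ∃ f g : EuclideanSpace ℝ (Fin d) → ℝ, ∃ T : EuclideanSpace ℝ (Fin d) → EuclideanSpace ℝ (Fin d),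
      Integrable f μ ∧ Integrable g ν ∧ Measurable T ∧ μ.map T = ν ∧
      (∀ x, ∀ y ∈ ball 0 R, f x + g y ≤ h (x - y)) ∧
      (∀ᵐ x ∂μ, f x + g (T x) = h (x - T x)) ∧
      ∀ᵐ x ∂μ, DifferentiableAt ℝ f x ∧
        ∀ y ∈ ball 0 R, f x + g y = h (x - y) → gradient f x ∈ subdifferential h (x - y) := by
  let K : Set (EuclideanSpace ℝ (Fin d)) := closedBall 0 R
  have hK : IsCompact K := isCompact_closedBall 0 R
  have hKm : MeasurableSet K := measurableSet_closedBall
  have : CompactSpace K := isCompact_iff_compactSpace.1 hK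
  have hemb : MeasurableEmbedding (Subtype.val : K → _) := .subtype_coe hKm
  have hlift : ∀ ρ : Measure (EuclideanSpace ℝ (Fin d)), IsProbabilityMeasure ρ →
      (∀ᵐ x ∂ρ, x ∈ ball 0 R) →
      ∃ ρ' : Measure K, IsProbabilityMeasure ρ' ∧ ρ'.map Subtype.val = ρ := by
    intro ρ _ hρ
    have e : (ρ.comap (Subtype.val : K → _)).map Subtype.val = ρ := by
      rw [map_comap_subtype_coe hKm, Measure.restrict_eq_self_of_ae_mem]
      filter_upwards [hρ] with x hx using ball_subset_closedBall hx
    refine ⟨_, ⟨?_⟩, e⟩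
    rw [← Set.preimage_univ (f := (Subtype.val : K → _)), ← hemb.map_apply, e, measure_univ]
  obtain ⟨μ', _, hμ'⟩ := hlift μ inferInstance hμR
  obtain ⟨ν', _, hν'⟩ := hlift ν inferInstance hνR
  have : Nonempty K := nonempty_of_isProbabilityMeasure μ'
  have hhc : Continuous h := hh.convexOn.locallyLipschitz.continuous
  let c : K → K → ℝ := fun x y => h (x - y)
  have hc : Continuous (Function.uncurry c) := by
    simp only [Function.uncurry_def, c]
    fun_prop
  obtain ⟨φ, hφ, hmax⟩ := exists_isMax_dualValue μ' ν' hc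
  let f : EuclideanSpace ℝ (Fin d) → ℝ := cTransform (fun x (y : K) => h (x - y)) φ
  have hcx : ∀ x, Continuous fun y : K => h (x - y) := fun x => by fun_prop
  have hfle : ∀ x, ∀ y : K, f x + φ y ≤ h (x - y) := fun x y =>
    cTransform_add_le (c := fun x (y : K) => h (x - y)) (hcx x) hφ y
  have hfcont : Continuous f := continuous_cTransform (by
    simp only [Function.uncurry_def]
    fun_prop) hφ
  have hdiff : ∀ᵐ x ∂μ, DifferentiableAt ℝ f x := by
    filter_upwards [hμ.ae_le (ae_differentiableAt_cTransform_sub hh.convexOn hK (R := R) hφ), hμR]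
      with x hx hxR using hx hxR
  have hgrad : ∀ x, DifferentiableAt ℝ f x → ∀ y : K, f x + φ y = h (x - y) →
      gradient f x ∈ subdifferential h (x - y) := fun x hx y hy =>
    gradient_mem_subdifferential hh.convexOn hx (fun x' => hfle x' y) hy
  have huniq : ∀ᵐ x ∂μ', ∀ y y', cTransform c φ x + φ y = c x y →
      cTransform c φ x + φ y' = c x y' → y = y' := by
    rw [← hμ', hemb.ae_map_iff] at hdiff
    filter_upwards [hdiff] with x hx y y' hy hy'
    have e := (gradInv_eq hh (hgrad x hx y hy)).symm.trans (gradInv_eq hh (hgrad x hx y' hy'))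
    exact Subtype.ext (sub_right_injective e)
  choose T₀ hT₀ using fun x => exists_cTransform_add_eq (c := c) (x := x) (hcx x) hφ
  have hT₀m := aemeasurable_of_cTransform_add_eq hc hφ huniq hT₀
  have hT₀map := map_eq_of_isMax hc hφ hmax huniq hT₀
  obtain ⟨T, hTm, hTT₀⟩ := hemb.exists_measurable_extend
    (measurable_subtype_coe.comp hT₀m.measurable_mk) (fun _ => inferInstance)
  have hT : ∀ᵐ x : K ∂μ', T x = T₀ x := by
    filter_upwards [hT₀m.ae_eq_mk] with x hx
    rw [hx]
    exact congrFun hTT₀ x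
  -- The value `0` off the ball is arbitrary: the constraint is only claimed for `y` in the ball,
  -- which carries `ν`.
  let g : EuclideanSpace ℝ (Fin d) → ℝ := Function.extend Subtype.val φ 0
  have hg : ∀ y : K, g y = φ y := fun y => Subtype.val_injective.extend_apply _ _ _
  refine ⟨f, g, T, ?_, ?_, hTm, ?_, ?_, ?_, ?_⟩
  · rw [← hμ', hemb.integrable_map_iff]
    exact integrable_of_continuous μ' (hfcont.comp continuous_subtype_val)
  · rw [← hν', hemb.integrable_map_iff]
    exact (integrable_of_continuous ν' hφ).congr (.of_forall fun y => (hg y).symm)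
  · rw [← hμ', Measure.map_map hTm measurable_subtype_coe, ← hν', ← hT₀map,
      AEMeasurable.map_map_of_aemeasurable measurable_subtype_coe.aemeasurable hT₀m]
    exact Measure.map_congr hT
  · intro x y hy
    have := hfle x ⟨y, ball_subset_closedBall hy⟩
    rwa [← hg] at this
  · rw [← hμ', hemb.ae_map_iff]
    filter_upwards [hT] with x hx
    rw [hx, hg]
    exact hT₀ x
  · filter_upwards [hdiff] with x hx
    refine ⟨hx, fun y hy hxy => hgrad x hx ⟨y, ball_subset_closedBall hy⟩ ?_⟩
    rwa [← hg]

end Euclidean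

/-! ### From potentials to the unique optimal plan. -/

section Transfer

variable {X Y : Type*} [MeasurableSpace X] [MeasurableSpace Y] {μ : Measure X} {ν : Measure Y}
  {c : X → Y → ℝ} {f : X → ℝ} {g : Y → ℝ} {T : X → Y}

theorem isCoupling_map_prodMk (hT : Measurable T) (hTν : μ.map T = ν) :
    IsCoupling μ ν (μ.map fun x => (x, T x)) := by
  have hm : Measurable fun x => (x, T x) := measurable_id.prodMk hT
  refine ⟨?_, ?_⟩
  · rw [Measure.map_map measurable_fst hm]
    exact Measure.map_id
  · rw [Measure.map_map measurable_snd hm]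
    exact hTν

/-- The potentials are only integrable, so the contact set is merely null-measurable for the graph
plan; that is enough to pull it back to `μ`. -/
theorem ae_map_prodMk_add_eq (hT : Measurable T) (hTν : μ.map T = ν) (hf : Integrable f μ)
    (hg : Integrable g ν)
    (hc : AEMeasurable (fun p : X × Y => c p.1 p.2) (μ.map fun x => (x, T x)))
    (heq : ∀ᵐ x ∂μ, f x + g (T x) = c x (T x)) :
    ∀ᵐ p ∂(μ.map fun x => (x, T x)), f p.1 + g p.2 = c p.1 p.2 := by
  have h := nullMeasurableSet_eq_fun
    ((isCoupling_map_prodMk hT hTν).integrable_add hf hg).aemeasurable hc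
  rw [ae_iff]
  exact (Measure.map_apply₀ (measurable_id.prodMk hT).aemeasurable h.compl).trans heq

/-- A transport map whose graph is, up to null sets, the contact set of a dual pair, induces the
unique optimal plan. -/
theorem isOptimalPlan_and_unique (hint : ∀ π, IsCoupling μ ν π →
      Integrable (fun p : X × Y => c p.1 p.2) π)
    (hT : Measurable T) (hTν : μ.map T = ν) (hf : Integrable f μ) (hg : Integrable g ν)
    (hle : ∀ π, IsCoupling μ ν π → ∀ᵐ p ∂π, f p.1 + g p.2 ≤ c p.1 p.2)
    (heq : ∀ᵐ x ∂μ, f x + g (T x) = c x (T x))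
    (huniq : ∀ π, IsCoupling μ ν π → ∀ᵐ p ∂π, f p.1 + g p.2 = c p.1 p.2 → p.2 = T p.1) :
    IsOptimalPlan c μ ν (μ.map fun x => (x, T x)) ∧
      ∀ π, IsOptimalPlan c μ ν π → π = μ.map fun x => (x, T x) := by
  have hcoup := isCoupling_map_prodMk hT hTν
  have hval : ∫ p, c p.1 p.2 ∂(μ.map fun x => (x, T x)) = ∫ x, f x ∂μ + ∫ y, g y ∂ν := by
    rw [← hcoup.integral_add hf hg]
    exact (integral_congr_ae (ae_map_prodMk_add_eq hT hTν hf hg (hint _ hcoup).aemeasurable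
      heq)).symm
  refine ⟨⟨hcoup, hint _ hcoup, fun π hπ => ?_⟩, fun π hπ => ?_⟩
  · rw [hval, ← hπ.integral_add hf hg]
    exact integral_mono_ae (hπ.integrable_add hf hg) (hint π hπ) (hle π hπ)
  · have hmin := hπ.2.2 _ hcoup
    rw [hval, ← hπ.1.integral_add hf hg] at hmin
    have hI := hπ.1.integrable_add hf hg
    -- The slack is nonnegative and, by optimality, has zero integral, hence vanishes `π`-a.e.
    have hnn : 0 ≤ᵐ[π] fun p => c p.1 p.2 - (f p.1 + g p.2) := by
      filter_upwards [hle π hπ.1] with p hp using sub_nonneg.2 hp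
    have hz : ∫ p, (c p.1 p.2 - (f p.1 + g p.2)) ∂π = 0 := by
      refine le_antisymm ?_ (integral_nonneg_of_ae hnn)
      rw [integral_sub hπ.2.1 hI]
      linarith
    rw [integral_eq_zero_iff_of_nonneg_ae hnn (hπ.2.1.sub hI)] at hz
    have hgraph : (fun p : X × Y => (p.1, T p.1)) =ᵐ[π] id := by
      filter_upwards [hz, huniq π hπ.1] with p hp hp'
      simp only [Pi.zero_apply] at hp
      exact Prod.ext rfl (hp' (by linarith)).symm
    calc π = π.map id := Measure.map_id.symm
      _ = π.map fun p => (p.1, T p.1) := (Measure.map_congr hgraph).symm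
      _ = (π.map Prod.fst).map fun x => (x, T x) :=
        (Measure.map_map (measurable_id.prodMk hT) measurable_fst).symm
      _ = μ.map fun x => (x, T x) := by rw [hπ.1.1]

theorem IsCoupling.integrable_of_continuous [TopologicalSpace X] [TopologicalSpace Y]
    [T2Space X] [T2Space Y] [OpensMeasurableSpace X] [OpensMeasurableSpace Y]
    [BorelSpace (X × Y)] [TopologicalSpace.PseudoMetrizableSpace (X × Y)]
    [IsProbabilityMeasure μ] {A : Set X} {B : Set Y} (hA : IsCompact A)
    (hB : IsCompact B) (hμA : μ Aᶜ = 0) (hνB : ν Bᶜ = 0)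
    (hc : Continuous fun p : X × Y => c p.1 p.2) {π : Measure (X × Y)} (hπ : IsCoupling μ ν π) :
    Integrable (fun p : X × Y => c p.1 p.2) π := by
  have := hπ.isProbabilityMeasure
  have h := hc.continuousOn.integrableOn_compact (μ := π) (hA.prod hB)
  rwa [IntegrableOn, Measure.restrict_eq_self_of_ae_mem] at h
  filter_upwards [hπ.ae_fst (P := (· ∈ A)) hμA, hπ.ae_snd (P := (· ∈ B)) hνB] with p h₁ h₂
  exact ⟨h₁, h₂⟩

end Transfer

/-- Preimages under `Φ` are images under its differentiable inverse, which preserves Lebesgue-null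
sets. -/
theorem absolutelyContinuous_map_diffeomorph {d : ℕ} {μ : Measure (EuclideanSpace ℝ (Fin d))}
    (hμ : μ ≪ volume) (Φ : Diffeomorph 𝓘(ℝ, EuclideanSpace ℝ (Fin d))
      𝓘(ℝ, EuclideanSpace ℝ (Fin d)) (EuclideanSpace ℝ (Fin d)) (EuclideanSpace ℝ (Fin d)) 1) :
    μ.map Φ ≪ volume := by
  refine Measure.AbsolutelyContinuous.mk fun s hs hs0 => ?_
  rw [Measure.map_apply Φ.continuous.measurable hs]
  refine hμ ?_
  have : Φ ⁻¹' s = Φ.symm '' s := (Φ.symm.toEquiv.image_eq_preimage_symm s).symm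
  rw [this]
  exact addHaar_image_eq_zero_of_differentiableOn_of_addHaar_eq_zero volume
    (Φ.symm.contDiff.differentiable one_ne_zero).differentiableOn hs0

end OptimalTransport

end

/-! ### The theorem in the original coordinates. -/

open OptimalTransport in
theorem theorem2 (d : ℕ)
    (Ω : Set (EuclideanSpace ℝ (Fin d))) (hΩ : IsCompact Ω)
    (hΩ_bdry : volume (frontier Ω) = 0)
    (μ ν : Measure (EuclideanSpace ℝ (Fin d)))
    [IsProbabilityMeasure μ] [IsProbabilityMeasure ν]
    (hμΩ : μ Ωᶜ = 0) (hνΩ : ν Ωᶜ = 0) (hμ : μ ≪ volume)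
    (h : EuclideanSpace ℝ (Fin d) → ℝ) (hh : StrictConvexOn ℝ Set.univ h)
    (Φμ Φν : Diffeomorph 𝓘(ℝ, EuclideanSpace ℝ (Fin d)) 𝓘(ℝ, EuclideanSpace ℝ (Fin d))
      (EuclideanSpace ℝ (Fin d)) (EuclideanSpace ℝ (Fin d)) 1) :
    (∀ π, OptimalTransport.IsCoupling μ ν π →
      Integrable (fun p : EuclideanSpace ℝ (Fin d) × EuclideanSpace ℝ (Fin d) =>
        h (Φμ p.1 - Φν p.2)) π) ∧
    (∃! π, OptimalTransport.IsOptimalPlan (fun x y => h (Φμ x - Φν y)) μ ν π) ∧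
    ∃ T : EuclideanSpace ℝ (Fin d) → EuclideanSpace ℝ (Fin d),
      Measurable T ∧
      OptimalTransport.IsOptimalPlan (fun x y => h (Φμ x - Φν y)) μ ν
        (μ.map fun x => (x, T x)) ∧
      ∃ f : EuclideanSpace ℝ (Fin d) → ℝ,
        OptimalTransport.IsKantorovichPotential (fun x y => h (x - y))
          (μ.map Φμ) (ν.map Φν) f ∧
        ∀ᵐ x ∂μ,
          DifferentiableAt ℝ f (Φμ x) ∧
          (∃ z, gradient f (Φμ x) ∈ OptimalTransport.subdifferential h z) ∧
          T x = Φν.symm (Φμ x - OptimalTransport.gradInv h (gradient f (Φμ x))) := by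
  have hhc : Continuous h := hh.convexOn.locallyLipschitz.continuous
  have hmμ : Measurable Φμ := Φμ.continuous.measurable
  have hmν : Measurable Φν := Φν.continuous.measurable
  have hint : ∀ π, IsCoupling μ ν π → Integrable
      (fun p : EuclideanSpace ℝ (Fin d) × EuclideanSpace ℝ (Fin d) => h (Φμ p.1 - Φν p.2)) π := by
    intro π hπ
    refine hπ.integrable_of_continuous (c := fun x y => h (Φμ x - Φν y)) hΩ hΩ hμΩ hνΩ ?_
    have := Φμ.continuous
    have := Φν.continuous
    fun_prop
  obtain ⟨R, hR⟩ : ∃ R, Φμ '' Ω ∪ Φν '' Ω ⊆ Metric.ball 0 R :=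
    ((hΩ.image Φμ.continuous).union (hΩ.image Φν.continuous)).isBounded.subset_ball 0
  have hμR : ∀ᵐ x ∂μ, Φμ x ∈ Metric.ball 0 R := by
    have : ∀ᵐ x ∂μ, x ∈ Ω := hμΩ
    filter_upwards [this] with x hx using hR (.inl ⟨x, hx, rfl⟩)
  have hνR : ∀ᵐ y ∂ν, Φν y ∈ Metric.ball 0 R := by
    have : ∀ᵐ y ∂ν, y ∈ Ω := hνΩ
    filter_upwards [this] with y hy using hR (.inr ⟨y, hy, rfl⟩)
  have hμR' : ∀ᵐ x ∂(μ.map Φμ), x ∈ Metric.ball 0 R :=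
    (ae_map_iff hmμ.aemeasurable measurableSet_ball).2 hμR
  have hνR' : ∀ᵐ y ∂(ν.map Φν), y ∈ Metric.ball 0 R :=
    (ae_map_iff hmν.aemeasurable measurableSet_ball).2 hνR
  have : IsProbabilityMeasure (μ.map Φμ) := Measure.isProbabilityMeasure_map hmμ.aemeasurable
  have : IsProbabilityMeasure (ν.map Φν) := Measure.isProbabilityMeasure_map hmν.aemeasurable
  obtain ⟨f, g, S, hf, hg, hS, hSν, hle, heq, hdiff⟩ := exists_potentials_and_map hh (μ.map Φμ)
    (ν.map Φν) (absolutelyContinuous_map_diffeomorph hμ Φμ) hμR' hνR'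
  have hfg : IsDualSolution (fun x y => h (x - y)) (μ.map Φμ) (ν.map Φν) f g := by
    have hcoup := isCoupling_map_prodMk hS hSν
    refine IsDualAdmissible.isDualSolution (fun x => by fun_prop) ⟨hf, hg, ?_⟩ hcoup ?_
    · filter_upwards [Measure.quasiMeasurePreserving_snd.ae hνR'] with p hp using hle _ _ hp
    · exact ae_map_prodMk_add_eq (c := fun x y => h (x - y)) hS hSν hf hg
        (by fun_prop : Continuous fun p : EuclideanSpace ℝ (Fin d) × EuclideanSpace ℝ (Fin d) =>
          h (p.1 - p.2)).aemeasurable heq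
  have heq' := ae_of_ae_map hmμ.aemeasurable heq
  have hdiff' := ae_of_ae_map hmμ.aemeasurable hdiff
  have hmsymm : Measurable Φν.symm := Φν.symm.continuous.measurable
  let T : EuclideanSpace ℝ (Fin d) → EuclideanSpace ℝ (Fin d) := fun x => Φν.symm (S (Φμ x))
  have hT : Measurable T := hmsymm.comp (hS.comp hmμ)
  have hΦT : ∀ x, Φν (T x) = S (Φμ x) := fun x => Φν.apply_symm_apply _
  have hTν : μ.map T = ν := by
    have : T = Φν.symm ∘ (S ∘ Φμ) := rfl
    rw [this, ← Measure.map_map hmsymm (hS.comp hmμ), ← Measure.map_map hS hmμ, hSν,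
      Measure.map_map hmsymm hmν]
    have : Φν.symm ∘ Φν = id := funext Φν.symm_apply_apply
    rw [this, Measure.map_id]
  -- The formula for `y` does not involve `y`, so it gives both the shape of `T` and the uniqueness
  -- of contact points.
  have hcontact : ∀ᵐ x ∂μ, ∀ y, Φν y ∈ Metric.ball 0 R → f (Φμ x) + g (Φν y) = h (Φμ x - Φν y) →
      gradient f (Φμ x) ∈ subdifferential h (Φμ x - Φν y) ∧
      y = Φν.symm (Φμ x - gradInv h (gradient f (Φμ x))) := by
    filter_upwards [hdiff'] with x hx y hy hxy
    have hmem := hx.2 _ hy hxy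
    refine ⟨hmem, ?_⟩
    rw [gradInv_eq hh hmem, sub_sub_cancel, Φν.symm_apply_apply]
  have hTR : ∀ᵐ x ∂μ, Φν (T x) ∈ Metric.ball 0 R := by
    rw [← hTν] at hνR
    exact ae_of_ae_map hT.aemeasurable hνR
  have hTx : ∀ᵐ x ∂μ, gradient f (Φμ x) ∈ subdifferential h (Φμ x - Φν (T x)) ∧
      T x = Φν.symm (Φμ x - gradInv h (gradient f (Φμ x))) := by
    filter_upwards [hcontact, hTR, heq'] with x h₁ h₂ h₃
    exact h₁ _ h₂ (by rw [hΦT]; exact h₃)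
  -- The primal problem is solved in the original coordinates, with the potentials composed with the
  -- diffeomorphisms.
  obtain ⟨hopt, hunique⟩ := isOptimalPlan_and_unique (c := fun x y => h (Φμ x - Φν y))
    (f := fun x => f (Φμ x)) (g := fun y => g (Φν y)) hint hT hTν (hf.comp_measurable hmμ)
    (hg.comp_measurable hmν)
    (fun π hπ => by
      filter_upwards [hπ.ae_snd hνR] with p hp using hle _ _ hp)
    (by
      filter_upwards [heq'] with x hx
      rw [hΦT]
      exact hx)
    (fun π hπ => by
      filter_upwards [hπ.ae_fst hcontact, hπ.ae_snd hνR, hπ.ae_fst hTx] with p h₁ h₂ h₃ h₄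
      rw [h₃.2]
      exact (h₁ _ h₂ h₄).2)
  refine ⟨hint, ⟨_, hopt, hunique⟩, T, hT, hopt, f, ⟨g, hfg⟩, ?_⟩
  filter_upwards [hdiff', hTx] with x h₁ h₂
  exact ⟨h₁.1, ⟨_, h₂.1⟩, h₂.2⟩
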